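/- Let $k$ be a field of characteristic zero (not necessarily algebraically closed), let $R=k[t]$, and let $A_1=k[t,\partial]$ be the first Weyl algebra over $k$, with $\partial t-t\partial=1$, acting on $k(t)$ by $\partial=d/dt$. For a right ideal $I$ of $A_1$, let $$H(I)=\{\sigma\in\mathrm{Aut}_k(A_1): \sigma(I)\simeq I \text{ as right } A_1\text{-modules}\}.$$ For a $k$-subspace $V$ of $R$, put $$S(V)=\{a\in R: aV\subseteq V\},\qquad \mathcal C(R,V)=\{a\in R: aR\subseteq V\},\qquad \mathcal D(R,V)=\{d\in k(t)[\partial]: d(R)\subseteq V\}.$$ The set $\mathcal D(R,V)$ is a right ideal of $A_1$; put $H(V)=H(\mathcal D(R,V))$. For $b\in R$ let $\mathcal O(b)=\{a\in R: a'\in bR\}$. A non-zero $k$-subspace $V$ of $R$ is called primary decomposable if $\mathcal O(b)\subseteq S(V)$ for some non-zero $b\in R$; a primary decomposable subspace is called irreducible if it is not contained in any proper ideal of $R$. Let $V$ and $W$ be two irreducible primary decomposable subspaces of $R$. If $H(V)\subseteq H(W)$, then $$\text{i)}\ \ S(V)\subseteq S(W)\qquad\text{and}\qquad \text{ii)}\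 \ \mathcal C(R,V)\subseteq\mathcal C(R,W).$$ -/

import Mathlib

open Polynomial

noncomputable section

namespace FirstWeyl

/-! ### The derivation `d/dt` of the field of rational functions `k(t)` -/

/-- The formal derivative of a rational function, by the quotient rule. -/
def ratDeriv {k : Type*} [Field k] (h : RatFunc k) : RatFunc k :=
  (algebraMap k[X] (RatFunc k) (derivative h.num) * algebraMap k[X] (RatFunc k) h.denom
    - algebraMap k[X] (RatFunc k) h.num * algebraMap k[X] (RatFunc k) (derivative h.denom))
    / (algebraMap k[X] (RatFunc k) h.denom) ^ 2

theorem algebraMap_ne {k : Type*} [Field k] {q : k[X]} (hq : q ≠ 0) :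
    algebraMap k[X] (RatFunc k) q ≠ 0 := by
  simpa using hq

theorem ratDeriv_div {k : Type*} [Field k] (p q : k[X]) (hq : q ≠ 0) :
    ratDeriv (algebraMap k[X] (RatFunc k) p / algebraMap k[X] (RatFunc k) q)
      = (algebraMap k[X] (RatFunc k) (derivative p) * algebraMap k[X] (RatFunc k) q
        - algebraMap k[X] (RatFunc k) p * algebraMap k[X] (RatFunc k) (derivative q))
        / (algebraMap k[X] (RatFunc k) q) ^ 2 := by
  set h : RatFunc k := algebraMap k[X] (RatFunc k) p / algebraMap k[X] (RatFunc k) q with hh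
  have hd : h.denom ≠ 0 := RatFunc.denom_ne_zero h
  have h1 : h.num * q = p * h.denom := by
    have e := RatFunc.num_div_denom h
    rw [hh, div_eq_div_iff (by simpa [← hh] using hd) (algebraMap_ne hq)] at e
    rw [← hh, ← map_mul, ← map_mul] at e
    exact RatFunc.algebraMap_injective k e
  have h2 := congrArg derivative h1
  simp only [derivative_mul] at h2
  unfold ratDeriv
  rw [div_eq_div_iff (pow_ne_zero 2 (algebraMap_ne hd)) (pow_ne_zero 2 (algebraMap_ne hq))]
  simp only [← map_mul, ← map_sub, ← map_pow]
  congr 1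
  linear_combination (h.denom * q) * h2
    - (derivative h.denom * q + h.denom * derivative q) * h1

theorem ratDeriv_add {k : Type*} [Field k] (x y : RatFunc k) :
    ratDeriv (x + y) = ratDeriv x + ratDeriv y := by
  have hx := algebraMap_ne (RatFunc.denom_ne_zero x)
  have hy := algebraMap_ne (RatFunc.denom_ne_zero y)
  conv_lhs => rw [← RatFunc.num_div_denom x, ← RatFunc.num_div_denom y, div_add_div _ _ hx hy]
  rw [← map_mul, ← map_mul, ← map_mul, ← map_add, ratDeriv_div _ _
    (mul_ne_zero (RatFunc.denom_ne_zero x) (RatFunc.denom_ne_zero y))]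
  unfold ratDeriv
  simp only [derivative_mul, map_add, map_mul]
  field_simp
  ring

theorem ratDeriv_mul {k : Type*} [Field k] (x y : RatFunc k) :
    ratDeriv (x * y) = x * ratDeriv y + y * ratDeriv x := by
  have hx := algebraMap_ne (RatFunc.denom_ne_zero x)
  have hy := algebraMap_ne (RatFunc.denom_ne_zero y)
  conv_lhs => rw [← RatFunc.num_div_denom x, ← RatFunc.num_div_denom y, div_mul_div_comm]
  conv_rhs =>
    rw [← RatFunc.num_div_denom x, ← RatFunc.num_div_denom y,
      ratDeriv_div _ _ (RatFunc.denom_ne_zero x), ratDeriv_div _ _ (RatFunc.denom_ne_zero y)]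
  rw [← map_mul, ← map_mul, ratDeriv_div _ _
    (mul_ne_zero (RatFunc.denom_ne_zero x) (RatFunc.denom_ne_zero y))]
  simp only [derivative_mul, map_add, map_mul]
  field_simp
  ring

theorem ratDeriv_algebraMap {k : Type*} [Field k] (p : k[X]) :
    ratDeriv (algebraMap k[X] (RatFunc k) p) = algebraMap k[X] (RatFunc k) (derivative p) := by
  have := ratDeriv_div p 1 one_ne_zero
  simpa using this

theorem algebraMap_eq_C {k : Type*} [Field k] (c : k) :
    algebraMap k (RatFunc k) c = algebraMap k[X] (RatFunc k) (C c) := by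
  rw [IsScalarTower.algebraMap_apply k k[X] (RatFunc k)]; rfl

theorem ratDeriv_smul {k : Type*} [Field k] (c : k) (x : RatFunc k) :
    ratDeriv (c • x) = c • ratDeriv x := by
  rw [Algebra.smul_def, Algebra.smul_def, ratDeriv_mul, algebraMap_eq_C, ratDeriv_algebraMap]
  simp

/-- The operator `∂ = d/dt` on `k(t)`. -/
def del (k : Type*) [Field k] : Module.End k (RatFunc k) where
  toFun := ratDeriv
  map_add' := ratDeriv_add
  map_smul' := ratDeriv_smul

/-- Multiplication by a rational function, as an operator on `k(t)`. -/
def mulOp (k : Type*) [Field k] : RatFunc k →ₐ[k] Module.End k (RatFunc k) :=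
  Algebra.lmul k (RatFunc k)

/-- The ring `k(t)[∂]` of differential operators with rational coefficients, as an algebra of
`k`-linear endomorphisms of `k(t)`. -/
def ratDiffOps (k : Type*) [Field k] : Subalgebra k (Module.End k (RatFunc k)) :=
  Algebra.adjoin k (Set.range (mulOp k) ∪ {del k})

/-- The first Weyl algebra `A₁ = k[t, ∂]`, as the algebra of operators generated by `t` and `∂`
inside `k(t)[∂]`. (In characteristic zero this is the algebra with generators `t`, `∂` and the
single relation `∂ t - t ∂ = 1`.) -/
def weylAlgebra (k : Type*) [Field k] : Subalgebra k (Module.End k (RatFunc k)) :=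
  Algebra.adjoin k {mulOp k RatFunc.X, del k}

theorem del_mulOp {k : Type*} [Field k] (a : RatFunc k) :
    del k * mulOp k a = mulOp k a * del k + mulOp k (ratDeriv a) := by
  ext x
  change ratDeriv (a * x) = a * ratDeriv x + ratDeriv a * x
  rw [ratDeriv_mul]; ring

theorem weyl_relation (k : Type*) [Field k] :
    del k * mulOp k RatFunc.X - mulOp k RatFunc.X * del k = 1 := by
  rw [del_mulOp, ← RatFunc.algebraMap_X, ratDeriv_algebraMap]
  simp

/-! ### Spaces of differential operators -/

/-- A subspace of `k[t]`, seen as a subspace of `k(t)`. -/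
def inRat {k : Type*} [Field k] (V : Submodule k k[X]) : Submodule k (RatFunc k) :=
  V.map (IsScalarTower.toAlgHom k k[X] (RatFunc k)).toLinearMap

theorem mem_inRat {k : Type*} [Field k] {V : Submodule k k[X]} {x : RatFunc k} :
    x ∈ inRat V ↔ ∃ p ∈ V, algebraMap k[X] (RatFunc k) p = x := by
  simp [inRat]

/-- `D(V, W) = {d ∈ k(t)[∂] : d(V) ⊆ W}` for subspaces `V`, `W` of `k(t)`. -/
def diffOps {k : Type*} [Field k] (V W : Submodule k (RatFunc k)) :
    Submodule k (Module.End k (RatFunc k)) where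
  carrier := {d | d ∈ ratDiffOps k ∧ ∀ v ∈ V, d v ∈ W}
  add_mem' := fun ha hb => ⟨add_mem ha.1 hb.1, fun v hv => W.add_mem (ha.2 v hv) (hb.2 v hv)⟩
  zero_mem' := ⟨zero_mem _, fun _ _ => W.zero_mem⟩
  smul_mem' := fun c _ ha =>
    ⟨(ratDiffOps k).smul_mem ha.1 c, fun v hv => W.smul_mem c (ha.2 v hv)⟩

theorem mem_diffOps {k : Type*} [Field k] {V W : Submodule k (RatFunc k)}
    {d : Module.End k (RatFunc k)} :
    d ∈ diffOps V W ↔ d ∈ ratDiffOps k ∧ ∀ v ∈ V, d v ∈ W := Iff.rfl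

theorem poly_mem_inRat_top {k : Type*} [Field k] (p : k[X]) :
    algebraMap k[X] (RatFunc k) p ∈ inRat (⊤ : Submodule k k[X]) :=
  mem_inRat.2 ⟨p, Submodule.mem_top, rfl⟩

theorem weylAlgebra_le (k : Type*) [Field k] : weylAlgebra k ≤ ratDiffOps k := by
  refine Algebra.adjoin_mono ?_
  rintro x (rfl | rfl)
  · exact Or.inl ⟨_, rfl⟩
  · exact Or.inr rfl

/-- Elements of the Weyl algebra map polynomials to polynomials. -/
theorem weyl_apply_poly {k : Type*} [Field k] {d : Module.End k (RatFunc k)}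
    (hd : d ∈ weylAlgebra k) : ∀ v ∈ inRat (⊤ : Submodule k k[X]), d v ∈ inRat ⊤ := by
  induction hd using Algebra.adjoin_induction with
  | mem x hx =>
    intro v hv
    obtain ⟨p, -, rfl⟩ := mem_inRat.1 hv
    rcases hx with rfl | rfl
    · refine mem_inRat.2 ⟨X * p, trivial, ?_⟩
      rw [map_mul, RatFunc.algebraMap_X]; rfl
    · exact mem_inRat.2 ⟨derivative p, trivial, (ratDeriv_algebraMap p).symm⟩
  | algebraMap r =>
    intro v hv
    exact Submodule.smul_mem _ r hv
  | add x y _ _ hx hy => exact fun v hv => Submodule.add_mem _ (hx v hv) (hy v hv)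
  | mul x y _ _ hx hy => exact fun v hv => hx _ (hy v hv)

theorem mulOp_poly_mem {k : Type*} [Field k] (p : k[X]) :
    mulOp k (algebraMap k[X] (RatFunc k) p) ∈ weylAlgebra k := by
  induction p using Polynomial.induction_on' with
  | add p q hp hq => rw [map_add, map_add]; exact add_mem hp hq
  | monomial n a =>
    rw [← C_mul_X_pow_eq_monomial, map_mul, map_mul, ← algebraMap_eq_C, AlgHom.commutes,
      map_pow, map_pow, RatFunc.algebraMap_X]
    exact mul_mem (Subalgebra.algebraMap_mem _ a)
      (pow_mem (Algebra.subset_adjoin (Set.mem_insert _ _)) n)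

/-- Elements of `k(t)[∂]` are the finite sums `a₀ + a₁ ∂ + ⋯ + aₙ ∂ⁿ` with `aᵢ ∈ k(t)`. -/
theorem ratDiffOps_eq_sum {k : Type*} [Field k] {d : Module.End k (RatFunc k)}
    (hd : d ∈ ratDiffOps k) :
    ∃ (n : ℕ) (a : ℕ → RatFunc k), d = ∑ i ∈ Finset.range n, mulOp k (a i) * del k ^ i := by
  let N : Submodule k (Module.End k (RatFunc k)) :=
    Submodule.span k {e | ∃ (a : RatFunc k) (i : ℕ), e = mulOp k a * del k ^ i}
  have key : ∀ x ∈ ratDiffOps k, ∀ e ∈ N, x * e ∈ N := by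
    intro x hx
    induction hx using Algebra.adjoin_induction with
    | mem x hx =>
      intro e he
      induction he using Submodule.span_induction with
      | mem e he =>
        obtain ⟨a, i, rfl⟩ := he
        rcases hx with ⟨b, rfl⟩ | rfl
        · refine Submodule.subset_span ⟨b * a, i, ?_⟩
          rw [map_mul, mul_assoc]
        · rw [← mul_assoc, del_mulOp, add_mul, mul_assoc, ← pow_succ']
          exact N.add_mem (Submodule.subset_span ⟨a, i + 1, rfl⟩)
            (Submodule.subset_span ⟨_, i, rfl⟩)
      | zero => rw [mul_zero]; exact N.zero_mem
      | add u v _ _ hu hv => rw [mul_add]; exact N.add_mem hu hv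
      | smul c u _ hu => rw [mul_smul_comm]; exact N.smul_mem c hu
    | algebraMap r =>
      intro e he
      rw [← Algebra.smul_def]; exact N.smul_mem r he
    | add x y _ _ hx hy => intro e he; rw [add_mul]; exact N.add_mem (hx e he) (hy e he)
    | mul x y _ _ hx hy => intro e he; rw [mul_assoc]; exact hx _ (hy e he)
  have hdN : d ∈ N := by
    have := key d hd 1 (Submodule.subset_span ⟨1, 0, by simp⟩)
    simpa using this
  clear key hd
  induction hdN using Submodule.span_induction with
  | mem e he =>
    obtain ⟨a, i, rfl⟩ := he
    refine ⟨i + 1, fun j => if j = i then a else 0, ?_⟩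
    rw [Finset.sum_eq_single i]
    · simp
    · intro j _ hj; simp [hj]
    · intro h; simp at h
  | zero => exact ⟨0, 0, by simp⟩
  | add u v _ _ hu hv =>
    obtain ⟨n, a, rfl⟩ := hu
    obtain ⟨m, b, rfl⟩ := hv
    have ext : ∀ (n N : ℕ) (a : ℕ → RatFunc k), n ≤ N →
        ∑ i ∈ Finset.range n, mulOp k (a i) * del k ^ i
          = ∑ i ∈ Finset.range N, mulOp k (if i < n then a i else 0) * del k ^ i := by
      intro n N a h
      rw [← Finset.sum_subset (Finset.range_mono h)]
      · refine Finset.sum_congr rfl fun i hi => ?_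
        rw [if_pos (Finset.mem_range.1 hi)]
      · intro i _ hi
        rw [if_neg (by simpa using hi)]; simp
    refine ⟨max n m, fun i => (if i < n then a i else 0) + (if i < m then b i else 0), ?_⟩
    rw [ext n _ a (le_max_left n m), ext m _ b (le_max_right n m), ← Finset.sum_add_distrib]
    exact Finset.sum_congr rfl fun i _ => by rw [map_add, add_mul]
  | smul c u _ hu =>
    obtain ⟨n, a, rfl⟩ := hu
    refine ⟨n, fun i => c • a i, ?_⟩
    rw [Finset.smul_sum]
    exact Finset.sum_congr rfl fun i _ => by rw [map_smul, smul_mul_assoc]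

theorem del_pow_poly {k : Type*} [Field k] (i : ℕ) (p : k[X]) :
    (del k ^ i) (algebraMap k[X] (RatFunc k) p)
      = algebraMap k[X] (RatFunc k) (derivative^[i] p) := by
  induction i with
  | zero => rfl
  | succ i ih =>
    rw [pow_succ', Module.End.mul_apply, ih, Function.iterate_succ_apply']
    exact ratDeriv_algebraMap _

theorem sum_apply_X_pow {k : Type*} [Field k] (n j : ℕ) (a : ℕ → RatFunc k) (hj : j < n) :
    (∑ i ∈ Finset.range n, mulOp k (a i) * del k ^ i) (algebraMap k[X] (RatFunc k) (X ^ j))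
      = ∑ i ∈ Finset.range j, a i * algebraMap k[X] (RatFunc k) (derivative^[i] (X ^ j))
        + (j.factorial : k) • a j := by
  have h2 : ∀ i, (mulOp k (a i) * del k ^ i) (algebraMap k[X] (RatFunc k) (X ^ j))
      = a i * algebraMap k[X] (RatFunc k) (derivative^[i] (X ^ j)) := by
    intro i
    rw [Module.End.mul_apply, del_pow_poly]; rfl
  have h5 : algebraMap k[X] (RatFunc k) (derivative^[j] (X ^ j))
      = algebraMap k (RatFunc k) (j.factorial : k) := by
    rw [algebraMap_eq_C, iterate_derivative_X_pow_eq_C_mul]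
    simp [Nat.descFactorial_self]
  rw [LinearMap.sum_apply, Finset.sum_congr rfl fun i _ => h2 i,
    ← Finset.sum_subset (Finset.range_mono (Nat.succ_le_of_lt hj)), Finset.sum_range_succ, h5,
    mul_comm (a j), ← Algebra.smul_def]
  intro i _ hi
  have hi' : j < i := by
    simp only [Nat.succ_eq_add_one, Finset.mem_range, not_lt] at hi
    omega
  rw [iterate_derivative_eq_zero (by simpa using hi'), map_zero, mul_zero]

/-- In characteristic zero, `D(R, R) ⊆ A₁` where `R = k[t]`. Together with `weyl_apply_poly`
this says `D(R, R) = A₁`, and so `D(R, V)` is a subset of `A₁` for every `V ⊆ R`. -/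
theorem diffOps_le_weyl {k : Type*} [Field k] [CharZero k] {d : Module.End k (RatFunc k)}
    (hd : d ∈ diffOps (inRat (⊤ : Submodule k k[X])) (inRat ⊤)) : d ∈ weylAlgebra k := by
  obtain ⟨hd1, hd2⟩ := mem_diffOps.1 hd
  obtain ⟨n, a, rfl⟩ := ratDiffOps_eq_sum hd1
  have ha : ∀ j, j < n → ∃ p : k[X], algebraMap k[X] (RatFunc k) p = a j := by
    intro j
    induction j using Nat.strong_induction_on with
    | _ j ih =>
      intro hj
      have h1 := hd2 (algebraMap k[X] (RatFunc k) (X ^ j)) (poly_mem_inRat_top _)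
      rw [sum_apply_X_pow n j a hj] at h1
      have h3 : ∑ i ∈ Finset.range j, a i * algebraMap k[X] (RatFunc k) (derivative^[i] (X ^ j))
          ∈ inRat (⊤ : Submodule k k[X]) := by
        refine Submodule.sum_mem _ fun i hi => ?_
        have hi' := Finset.mem_range.1 hi
        obtain ⟨p, hp⟩ := ih i hi' (hi'.trans hj)
        rw [← hp, ← map_mul]
        exact poly_mem_inRat_top _
      have h4 := (Submodule.add_mem_iff_right _ h3).1 h1
      rw [Submodule.smul_mem_iff _ (Nat.cast_ne_zero.2 (Nat.factorial_ne_zero j))] at h4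
      obtain ⟨p, -, hp⟩ := mem_inRat.1 h4
      exact ⟨p, hp⟩
  have hdel : del k ∈ weylAlgebra k := Algebra.subset_adjoin (Set.mem_insert_of_mem _ rfl)
  refine sum_mem fun i hi => mul_mem ?_ (pow_mem hdel i)
  obtain ⟨p, hp⟩ := ha i (Finset.mem_range.1 hi)
  rw [← hp]; exact mulOp_poly_mem p

/-- The right ideal `D(R, V)` of `A₁`, where `R = k[t]` and `V` is a subspace of `R`. -/
def idealOf {k : Type*} [Field k] (V : Submodule k k[X]) :
    Submodule (weylAlgebra k)ᵐᵒᵖ (weylAlgebra k) where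
  carrier := {d : weylAlgebra k | d.1 ∈ diffOps (inRat ⊤) (inRat V)}
  add_mem' := fun {_ _} ha hb => (diffOps (inRat ⊤) (inRat V)).add_mem ha hb
  zero_mem' := (diffOps (inRat ⊤) (inRat V)).zero_mem
  smul_mem' := fun c x hx =>
    ⟨weylAlgebra_le k (MulOpposite.op c.unop • x).2,
      fun v hv => hx.2 _ (weyl_apply_poly c.unop.2 v hv)⟩

/-- As a set of operators, the right ideal `idealOf V` is all of `D(R, V)`. -/
theorem coe_idealOf {k : Type*} [Field k] [CharZero k] (V : Submodule k k[X]) :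
    (Subtype.val '' (idealOf V : Set (weylAlgebra k)) : Set (Module.End k (RatFunc k)))
      = diffOps (inRat ⊤) (inRat V) := by
  ext d
  constructor
  · rintro ⟨x, hx, rfl⟩; exact hx
  · intro hd
    exact ⟨⟨d, diffOps_le_weyl ⟨hd.1, fun v hv => Submodule.map_mono le_top (hd.2 v hv)⟩⟩, hd, rfl⟩

/-! ### Stafford subgroups -/

/-- The image `σ(I)` of a right ideal under an automorphism. -/
def mapIdeal {k A : Type*} [Field k] [Ring A] [Algebra k A] (σ : A ≃ₐ[k] A)
    (I : Submodule Aᵐᵒᵖ A) : Submodule Aᵐᵒᵖ A where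
  carrier := σ '' I
  add_mem' := by
    rintro _ _ ⟨x, hx, rfl⟩ ⟨y, hy, rfl⟩
    exact ⟨x + y, I.add_mem hx hy, map_add σ x y⟩
  zero_mem' := ⟨0, I.zero_mem, map_zero σ⟩
  smul_mem' := by
    rintro c _ ⟨x, hx, rfl⟩
    refine ⟨MulOpposite.op (σ.symm c.unop) • x, I.smul_mem _ hx, ?_⟩
    simp [MulOpposite.smul_eq_mul_unop]

theorem mapIdeal_mul {k A : Type*} [Field k] [Ring A] [Algebra k A] (σ τ : A ≃ₐ[k] A)
    (I : Submodule Aᵐᵒᵖ A) : mapIdeal (σ * τ) I = mapIdeal σ (mapIdeal τ I) := by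
  apply SetLike.coe_injective
  change (fun x => σ (τ x)) '' (I : Set A) = σ '' (τ '' I)
  rw [Set.image_image]

theorem mapIdeal_one {k A : Type*} [Field k] [Ring A] [Algebra k A]
    (I : Submodule Aᵐᵒᵖ A) : mapIdeal (1 : A ≃ₐ[k] A) I = I := by
  apply SetLike.coe_injective
  change (fun x => x) '' (I : Set A) = I
  simp

theorem mapIdeal_congr {k A : Type*} [Field k] [Ring A] [Algebra k A] (σ : A ≃ₐ[k] A)
    {I J : Submodule Aᵐᵒᵖ A} (e : I ≃ₗ[Aᵐᵒᵖ] J) :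
    Nonempty (mapIdeal σ I ≃ₗ[Aᵐᵒᵖ] mapIdeal σ J) := by
  have hm : ∀ {K : Submodule Aᵐᵒᵖ A} (x : mapIdeal σ K), σ.symm x.1 ∈ K := by
    rintro K ⟨_, y, hy, rfl⟩; simpa using hy
  refine ⟨{ toFun := fun x => ⟨σ (e ⟨σ.symm x.1, hm x⟩), _, (e ⟨σ.symm x.1, hm x⟩).2, rfl⟩
            invFun := fun x =>
              ⟨σ (e.symm ⟨σ.symm x.1, hm x⟩), _, (e.symm ⟨σ.symm x.1, hm x⟩).2, rfl⟩
            map_add' := ?_, map_smul' := ?_, left_inv := ?_, right_inv := ?_ }⟩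
  · intro x y
    apply Subtype.ext
    have : (⟨σ.symm (x + y).1, hm (x + y)⟩ : I) = ⟨σ.symm x.1, hm x⟩ + ⟨σ.symm y.1, hm y⟩ :=
      Subtype.ext (map_add σ.symm x.1 y.1)
    change σ (e _) = σ (e _) + σ (e _)
    rw [this, map_add, ← map_add σ]; rfl
  · intro c x
    apply Subtype.ext
    have : (⟨σ.symm (c • x).1, hm (c • x)⟩ : I)
        = MulOpposite.op (σ.symm c.unop) • ⟨σ.symm x.1, hm x⟩ :=
      Subtype.ext (by simp [MulOpposite.smul_eq_mul_unop])
    change σ (e _) = c • σ (e _)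
    rw [this, map_smul]
    simp [MulOpposite.smul_eq_mul_unop]
  · intro x
    simp
  · intro x
    simp

/-- The Stafford subgroup `H(I) = {σ ∈ Aut_k(A) : σ(I) ≃ I as right A-modules}` of a right
ideal `I`. -/
def stafford (k : Type*) {A : Type*} [Field k] [Ring A] [Algebra k A] (I : Submodule Aᵐᵒᵖ A) :
    Subgroup (A ≃ₐ[k] A) where
  carrier := {σ | Nonempty (mapIdeal σ I ≃ₗ[Aᵐᵒᵖ] I)}
  mul_mem' := by
    rintro σ τ ⟨e⟩ ⟨f⟩
    obtain ⟨g⟩ := mapIdeal_congr σ f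
    exact ⟨(LinearEquiv.ofEq _ _ (mapIdeal_mul σ τ I)).trans (g.trans e)⟩
  one_mem' := ⟨LinearEquiv.ofEq _ _ (mapIdeal_one I)⟩
  inv_mem' := by
    rintro σ ⟨e⟩
    obtain ⟨g⟩ := mapIdeal_congr σ⁻¹ e
    refine ⟨g.symm.trans (LinearEquiv.ofEq _ _ ?_)⟩
    rw [← mapIdeal_mul, inv_mul_cancel, mapIdeal_one]

/-- `H(V) = H(D(R, V))`. -/
def staffordOf {k : Type*} [Field k] (V : Submodule k k[X]) :
    Subgroup (weylAlgebra k ≃ₐ[k] weylAlgebra k) :=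
  stafford k (idealOf V)

/-! ### Primary decomposable subspaces -/

/-- `O(b) = {a ∈ k[t] : a' ∈ b k[t]}`. -/
def primaryAlg {k : Type*} [Field k] (b : k[X]) : Subalgebra k k[X] where
  carrier := {a | b ∣ derivative a}
  mul_mem' := fun {x y} hx hy => by
    change b ∣ derivative (x * y)
    rw [derivative_mul]
    exact dvd_add (Dvd.dvd.mul_right hx y) (Dvd.dvd.mul_left hy x)
  add_mem' := fun {x y} hx hy => by
    change b ∣ derivative (x + y)
    rw [derivative_add]
    exact dvd_add hx hy
  algebraMap_mem' := fun r => by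
    change b ∣ derivative (C r)
    simp

/-- `S(V) = {a ∈ k[t] : a V ⊆ V}`. -/
def stab {k : Type*} [Field k] (V : Submodule k k[X]) : Subalgebra k k[X] where
  carrier := {a | ∀ v ∈ V, a * v ∈ V}
  mul_mem' := fun {x y} hx hy v hv => by rw [mul_assoc]; exact hx _ (hy v hv)
  add_mem' := fun {x y} hx hy v hv => by rw [add_mul]; exact V.add_mem (hx v hv) (hy v hv)
  algebraMap_mem' := fun r v hv => by rw [← Algebra.smul_def]; exact V.smul_mem r hv

/-- `C(R, V) = {a ∈ k[t] : a k[t] ⊆ V}`. -/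
def conductor {k : Type*} [Field k] (V : Submodule k k[X]) : Ideal k[X] where
  carrier := {a | ∀ r : k[X], a * r ∈ V}
  add_mem' := fun {x y} hx hy r => by rw [add_mul]; exact V.add_mem (hx r) (hy r)
  zero_mem' := fun r => by rw [zero_mul]; exact V.zero_mem
  smul_mem' := fun c x hx r => by
    rw [smul_eq_mul, mul_comm c x, mul_assoc]; exact hx _

/-- A nonzero subspace `V` of `k[t]` is primary decomposable if `S(V)` contains `O(b)` for some
`b ≠ 0`. -/
def IsPrimaryDecomposable {k : Type*} [Field k] (V : Submodule k k[X]) : Prop :=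
  V ≠ ⊥ ∧ ∃ b : k[X], b ≠ 0 ∧ primaryAlg b ≤ stab V

/-- A primary decomposable subspace is irreducible if it is not contained in a proper ideal
of `k[t]`. -/
def IsPDIrreducible {k : Type*} [Field k] (V : Submodule k k[X]) : Prop :=
  IsPrimaryDecomposable V ∧
    ¬ ∃ I : Ideal k[X], I ≠ ⊤ ∧ (V : Set k[X]) ⊆ (I : Set k[X])

end FirstWeyl

end

/-! The elements of `S(V)` are detected by exponentials. If `s ∈ S(V)`, then `s` multiplies `D(R,V)`
into itself from the left, so every automorphism `exp(c ad s)`, `c ∈ k`, preserves `D(R,V)` and lies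
in `H(V)` (`flowEquiv_mem_stafford`), hence in `H(W)`.

Put `I = D(R,W)` and `σ = exp(c ad s)`. An isomorphism `σ(I) ≃ I` is left multiplication by a unit
of `k(t)[∂]`, that is, by a rational function. Since `σ` fixes `k[t]`, both ideals contain the same
polynomials, namely the nonzero conductor of `W`; this forces the factor to be a constant, so `σ(I)
⊆ I` (`apply_mem_idealOf_of_mem_staffordOf`). As this holds for all `c`, the coefficient of `c`
gives `[s, I] ⊆ I`, so `sI ⊆ I` (`mul_mem_of_forall_flowEquiv_mem`). Evaluating at `1`, where `I`
takes every value in `W` (`exists_mem_idealOf_apply_one`), gives `sW ⊆ W`. This is i).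

For ii), irreducibility means that `V` generates the unit ideal, so the conductor of `V` is the
largest ideal of `R` inside `S(V)` (`mem_conductor_iff_of_irreducible`) and is monotone in `S(V)`.
-/

noncomputable section

namespace FirstWeyl

/-! ### The flow of a locally nilpotent inner derivation -/

section Flow

variable {k A : Type*} [Field k] [Ring A] [Algebra k A]

/-- The polynomial curves in `A` that solve the differential equation `f' = [s, f]`. -/
def flowAlg (k : Type*) {A : Type*} [Field k] [Ring A] [Algebra k A] (s : A) :
    Subalgebra k A[X] where
  carrier := {f | derivative f = C s * f - f * C s}
  mul_mem' := fun {x y} hx hy => by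
    simp only [Set.mem_ofPred_eq] at hx hy ⊢
    rw [derivative_mul, hx, hy]; noncomm_ring
  add_mem' := fun {x y} hx hy => by
    simp only [Set.mem_ofPred_eq] at hx hy ⊢
    rw [derivative_add, hx, hy]; noncomm_ring
  algebraMap_mem' := fun r => by
    simp only [Set.mem_ofPred_eq]
    rw [Polynomial.algebraMap_apply, derivative_C, ← C_mul, ← C_mul, Algebra.commutes, sub_self]

theorem mem_flowAlg {s : A} {f : A[X]} :
    f ∈ flowAlg k s ↔ derivative f = C s * f - f * C s := Iff.rfl

/-- In characteristic zero this recursion makes the `n`-th coefficient `(ad s)ⁿ(f₀) / n!`: a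
solution is the exponential series of its initial value. -/
theorem coeff_succ_of_mem_flowAlg {s : A} {f : A[X]} (hf : f ∈ flowAlg k s) (n : ℕ) :
    ((n : k) + 1) • f.coeff (n + 1) = s * f.coeff n - f.coeff n * s := by
  have h := congrArg (fun g => g.coeff n) (mem_flowAlg.1 hf)
  simp only [coeff_derivative, coeff_sub, coeff_C_mul, coeff_mul_C] at h
  rw [← h, Algebra.smul_def, Algebra.commutes]
  simp

/-- Evaluation of polynomials over `A` at a scalar. -/
def scalarEval (A : Type*) {k : Type*} [Field k] [Ring A] [Algebra k A] (c : k) :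
    A[X] →ₐ[k] A :=
  eval₂AlgHom (AlgHom.id k A) (algebraMap k A c) fun a => Algebra.commute_algebraMap_right c a

theorem scalarEval_C (c : k) (a : A) : scalarEval A c (C a) = a :=
  eval₂_C (RingHom.id A) (algebraMap k A c)

theorem scalarEval_X (c : k) : scalarEval A c (X : A[X]) = algebraMap k A c :=
  eval₂_X (RingHom.id A) (algebraMap k A c)

theorem scalarEval_eq_sum (c : k) (f : A[X]) :
    scalarEval A c f = ∑ n ∈ Finset.range (f.natDegree + 1), c ^ n • f.coeff n := by
  change eval₂ (RingHom.id A) (algebraMap k A c) f = _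
  rw [eval₂_eq_sum_range]
  refine Finset.sum_congr rfl fun n _ => ?_
  rw [Algebra.smul_def, map_pow, ← map_pow, ← Algebra.commutes]; rfl

theorem scalarEval_zero (f : A[X]) : scalarEval A (0 : k) f = f.coeff 0 := by
  change eval₂ (RingHom.id A) (algebraMap k A 0) f = _
  rw [map_zero, eval₂_at_zero]; rfl

theorem coeff_mem_of_mem_flowAlg [CharZero k] {s : A} {f : A[X]} (hf : f ∈ flowAlg k s)
    (J : Submodule k A) (hJ : ∀ x ∈ J, s * x - x * s ∈ J) (h0 : f.coeff 0 ∈ J) (n : ℕ) :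
    f.coeff n ∈ J := by
  induction n with
  | zero => exact h0
  | succ n ih =>
    rw [← Submodule.smul_mem_iff J (Nat.cast_add_one_ne_zero n : (n : k) + 1 ≠ 0),
      coeff_succ_of_mem_flowAlg hf]
    exact hJ _ ih

theorem scalarEval_mem {J : Submodule k A} {f : A[X]} (hf : ∀ n, f.coeff n ∈ J) (c : k) :
    scalarEval A c f ∈ J := by
  rw [scalarEval_eq_sum]
  exact J.sum_mem fun n _ => J.smul_mem _ (hf n)

/-- Linear functionals separate the points of `A/J`. Applying one to the coefficients gives a
polynomial over `k` that vanishes on the infinite field `k`. -/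
theorem coeff_mem_of_forall_scalarEval_mem [Infinite k] {J : Submodule k A} {f : A[X]}
    (hf : ∀ c : k, scalarEval A c f ∈ J) (n : ℕ) : f.coeff n ∈ J := by
  rw [← Submodule.Quotient.mk_eq_zero, ← Module.forall_dual_apply_eq_zero_iff k]
  intro φ
  set ψ : A →ₗ[k] k := φ.comp J.mkQ
  change ψ (f.coeff n) = 0
  have h : (∑ i ∈ Finset.range (f.natDegree + 1), monomial i (ψ (f.coeff i)) : k[X]) = 0 := by
    refine Polynomial.funext fun c => ?_
    have h1 : ψ (scalarEval A c f) = 0 := by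
      change φ (J.mkQ _) = 0
      rw [Submodule.mkQ_apply, (Submodule.Quotient.mk_eq_zero J).2 (hf c), map_zero]
    rw [scalarEval_eq_sum, map_sum] at h1
    rw [eval_finsetSum, eval_zero, ← h1]
    refine Finset.sum_congr rfl fun i _ => ?_
    rw [eval_monomial, map_smul, smul_eq_mul, mul_comm]
  by_cases hn : n ∈ Finset.range (f.natDegree + 1)
  · have h2 := congrArg (fun g => g.coeff n) h
    simp only [finsetSum_coeff, coeff_monomial, coeff_zero] at h2
    rwa [Finset.sum_ite_eq' , if_pos hn] at h2
  · rw [coeff_eq_zero_of_natDegree_lt (by simpa using hn), map_zero]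

/-- The initial value of a solution of `f' = [s, f]`. -/
def initialValue (k : Type*) {A : Type*} [Field k] [Ring A] [Algebra k A] (s : A) :
    flowAlg k s →ₐ[k] A :=
  (scalarEval A (0 : k)).comp (flowAlg k s).val

theorem initialValue_apply {s : A} (f : flowAlg k s) : initialValue k s f = f.1.coeff 0 :=
  scalarEval_zero f.1

theorem initialValue_injective [CharZero k] (s : A) :
    Function.Injective (initialValue k s) := by
  rw [injective_iff_map_eq_zero]
  intro f hf
  rw [initialValue_apply] at hf
  refine Subtype.ext (Polynomial.ext fun n => ?_)
  have := coeff_mem_of_mem_flowAlg f.2 ⊥ (by simp) ((Submodule.mem_bot k).2 hf) n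
  simpa using this

theorem C_mem_flowAlg {s a : A} (h : Commute s a) : C a ∈ flowAlg k s := by
  rw [mem_flowAlg, derivative_C, ← C_mul, ← C_mul, h.eq, sub_self]

theorem linear_mem_flowAlg {s a : A} (h : Commute s (s * a - a * s)) :
    C a + X * C (s * a - a * s) ∈ flowAlg k s := by
  rw [mem_flowAlg, derivative_add, derivative_mul, derivative_X, derivative_C, derivative_C,
    mul_add, add_mul, ← mul_assoc, ← X_mul_C s, mul_assoc, mul_assoc, ← C_mul, ← C_mul, ← C_mul,
    ← C_mul, ← h.eq]
  simp

/-- Solutions form an algebra, so it suffices to solve for generators, where the exponential series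
stops after its linear term. This replaces a proof that `ad s` is locally nilpotent. -/
theorem initialValue_surjective {s : A} {G : Set A} (hG : Algebra.adjoin k G = ⊤)
    (hs : ∀ g ∈ G, Commute s (s * g - g * s)) : Function.Surjective (initialValue k s) := by
  rw [← AlgHom.range_eq_top, eq_top_iff, ← hG, Algebra.adjoin_le_iff]
  intro g hg
  exact ⟨⟨_, linear_mem_flowAlg (hs g hg)⟩, (initialValue_apply _).trans (by simp)⟩

/-! ### Exponential automorphisms and the right ideals they preserve. -/

variable [CharZero k] {s : A} {G : Set A} (hG : Algebra.adjoin k G = ⊤)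
  (hs : ∀ g ∈ G, Commute s (s * g - g * s))

/-- The solution of `f' = [s, f]` with given initial value. -/
def integralCurve : A ≃ₐ[k] flowAlg k s :=
  (AlgEquiv.ofBijective (initialValue k s)
    ⟨initialValue_injective s, initialValue_surjective hG hs⟩).symm

theorem integralCurve_eq {f : A[X]} (hf : f ∈ flowAlg k s) :
    (integralCurve hG hs (f.coeff 0)).1 = f := by
  have : integralCurve hG hs (f.coeff 0) = ⟨f, hf⟩ := by
    rw [integralCurve, AlgEquiv.symm_apply_eq]
    exact (initialValue_apply ⟨f, hf⟩).symm
  rw [this]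

theorem coeff_zero_integralCurve (a : A) : (integralCurve hG hs a).1.coeff 0 = a := by
  rw [← initialValue_apply]
  exact (AlgEquiv.ofBijective (initialValue k s) _).apply_symm_apply a

/-- The endomorphism `exp (c ad s)`. -/
def flowHom (c : k) : A →ₐ[k] A :=
  (scalarEval A c).comp ((flowAlg k s).val.comp (integralCurve hG hs).toAlgHom)

theorem flowHom_apply (c : k) (a : A) :
    flowHom hG hs c a = scalarEval A c (integralCurve hG hs a).1 := rfl

theorem flowHom_of_commute (c : k) {a : A} (h : Commute s a) : flowHom hG hs c a = a := by
  have := integralCurve_eq hG hs (C_mem_flowAlg h)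
  rw [coeff_C_zero] at this
  rw [flowHom_apply, this, scalarEval_C]

theorem flowHom_of_mem (c : k) {a : A} (h : a ∈ G) :
    flowHom hG hs c a = a + c • (s * a - a * s) := by
  have := integralCurve_eq hG hs (linear_mem_flowAlg (hs a h))
  have h0 : (C a + X * C (s * a - a * s) : A[X]).coeff 0 = a := by simp
  rw [h0] at this
  rw [flowHom_apply, this, map_add, map_mul, scalarEval_C, scalarEval_C, scalarEval_X,
    Algebra.smul_def]

theorem flowHom_comp_neg (c d : k) (hcd : c + d = 0) :
    (flowHom hG hs c).comp (flowHom hG hs d) = AlgHom.id k A := by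
  refine AlgHom.ext_of_adjoin_eq_top hG fun a ha => ?_
  rw [AlgHom.comp_apply, flowHom_of_mem hG hs d ha, map_add, map_smul, flowHom_of_mem hG hs c ha,
    flowHom_of_commute hG hs c (hs a ha), add_assoc, ← add_smul, hcd, zero_smul, add_zero]
  rfl

/-- The automorphism `exp (c ad s)`. -/
def flowEquiv (c : k) : A ≃ₐ[k] A :=
  AlgEquiv.ofAlgHom (flowHom hG hs c) (flowHom hG hs (-c))
    (flowHom_comp_neg hG hs _ _ (add_neg_cancel c)) (flowHom_comp_neg hG hs _ _ (neg_add_cancel c))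

theorem flowHom_mem (J : Submodule k A) (hJ : ∀ x ∈ J, s * x - x * s ∈ J) (c : k) {a : A}
    (ha : a ∈ J) : flowHom hG hs c a ∈ J :=
  scalarEval_mem (coeff_mem_of_mem_flowAlg (integralCurve hG hs a).2 J hJ
    (by rwa [coeff_zero_integralCurve])) c

/-- The commutator is the linear coefficient of the curve `c ↦ exp(c ad s)(a)`, all of whose values
lie in `J`. -/
theorem commutator_mem_of_forall_flowHom_mem (J : Submodule k A) {a : A}
    (ha : ∀ c, flowHom hG hs c a ∈ J) : s * a - a * s ∈ J := by
  have h := coeff_succ_of_mem_flowAlg (integralCurve hG hs a).2 0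
  rw [coeff_zero_integralCurve] at h
  rw [← h]
  exact J.smul_mem _ (coeff_mem_of_forall_scalarEval_mem ha _)

/-- A right ideal, as a subspace. -/
def rightIdealSubspace (I : Submodule Aᵐᵒᵖ A) : Submodule k A where
  carrier := I
  add_mem' := I.add_mem
  zero_mem' := I.zero_mem
  smul_mem' := fun c x hx => by
    rw [Algebra.smul_def, Algebra.commutes]
    exact I.smul_mem (MulOpposite.op (algebraMap k A c)) hx

theorem mul_mem_rightIdeal {I : Submodule Aᵐᵒᵖ A} {x : A} (hx : x ∈ I) (a : A) : x * a ∈ I :=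
  I.smul_mem (MulOpposite.op a) hx

/-- A right ideal stable under left multiplication by `s` is stable under `ad s`, so both `exp(c ad
s)` and its inverse preserve it: the image equals `I`. -/
theorem flowEquiv_mem_stafford {I : Submodule Aᵐᵒᵖ A} (hI : ∀ x ∈ I, s * x ∈ I) (c : k) :
    flowEquiv hG hs c ∈ stafford k I := by
  have hJ : ∀ x ∈ rightIdealSubspace (k := k) I, s * x - x * s ∈ rightIdealSubspace (k := k) I :=
    fun x hx => sub_mem (hI x hx) (mul_mem_rightIdeal hx s)
  refine ⟨LinearEquiv.ofEq _ _ (SetLike.ext fun x => ⟨?_, fun hx => ?_⟩)⟩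
  · rintro ⟨y, hy, rfl⟩
    exact flowHom_mem hG hs _ hJ c hy
  · exact ⟨(flowEquiv hG hs c).symm x, flowHom_mem hG hs _ hJ (-c) hx,
      (flowEquiv hG hs c).apply_symm_apply x⟩

theorem mul_mem_of_forall_flowEquiv_mem {I : Submodule Aᵐᵒᵖ A} {x : A} (hx : x ∈ I)
    (h : ∀ c : k, flowEquiv hG hs c x ∈ I) : s * x ∈ I := by
  have := I.add_mem (commutator_mem_of_forall_flowHom_mem hG hs (rightIdealSubspace I) h)
    (mul_mem_rightIdeal hx s)
  rwa [sub_add_cancel] at this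

end Flow

/-! ### Units of the ring of differential operators -/

section Commutator

variable {B : Type*} [Ring B]

/-- The inner derivation `x ↦ x t - t x`. -/
def rightCommutator (t : B) : B →+ B := AddMonoidHom.mulRight t - AddMonoidHom.mulLeft t

theorem rightCommutator_apply (t x : B) : rightCommutator t x = x * t - t * x := rfl

theorem rightCommutator_mul (t x y : B) :
    rightCommutator t (x * y) = rightCommutator t x * y + x * rightCommutator t y := by
  simp only [rightCommutator_apply]; noncomm_ring

theorem iterate_rightCommutator_zero (t : B) (n : ℕ) : (rightCommutator t)^[n] 0 = 0 :=
  iterate_map_zero _ n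

theorem iterate_rightCommutator_add (t x y : B) (n : ℕ) :
    (rightCommutator t)^[n] (x + y) = (rightCommutator t)^[n] x + (rightCommutator t)^[n] y :=
  iterate_map_add _ n x y

theorem iterate_rightCommutator_eq_zero {t x : B} {n m : ℕ} (hx : (rightCommutator t)^[n] x = 0)
    (h : n ≤ m) : (rightCommutator t)^[m] x = 0 := by
  obtain ⟨i, rfl⟩ := Nat.exists_eq_add_of_le' h
  rw [Function.iterate_add_apply, hx, iterate_rightCommutator_zero]

/-- The top-order part of the Leibniz rule. -/
theorem iterate_rightCommutator_mul {t : B} (n m : ℕ) {x y : B}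
    (hx : (rightCommutator t)^[n + 1] x = 0) (hy : (rightCommutator t)^[m + 1] y = 0) :
    (rightCommutator t)^[n + m] (x * y)
      = (n + m).choose n • ((rightCommutator t)^[n] x * (rightCommutator t)^[m] y) := by
  generalize hN : n + m = N
  induction N generalizing n m x y with
  | zero =>
    obtain ⟨rfl, rfl⟩ : n = 0 ∧ m = 0 := by omega
    simp
  | succ N ih =>
    rw [Function.iterate_succ_apply, rightCommutator_mul, iterate_rightCommutator_add]
    rcases n with _ | n
    · obtain rfl : m = N + 1 := by omega
      have hx' : rightCommutator t x = 0 := hx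
      rw [hx', zero_mul, iterate_rightCommutator_zero, zero_add,
        ih 0 N hx (by rwa [Function.iterate_succ_apply] at hy) (by omega)]
      simp
    · rcases m with _ | m
      · obtain rfl : n = N := by omega
        have hy' : rightCommutator t y = 0 := hy
        rw [hy', mul_zero, iterate_rightCommutator_zero, add_zero,
          ih n 0 (by rwa [Function.iterate_succ_apply] at hx) hy (by omega)]
        simp
      -- Each of the two Leibniz terms lowers one degree by one; their binomial coefficients add by
      -- Pascal's rule.
      · rw [ih n (m + 1) (by rwa [Function.iterate_succ_apply] at hx) hy (by omega),
          ih (n + 1) m hx (by rwa [Function.iterate_succ_apply] at hy) (by omega),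
          Nat.choose_succ_succ, add_smul, Function.iterate_succ_apply, Function.iterate_succ_apply]

theorem exists_iterate_rightCommutator_mul {t x y : B}
    (hx : ∃ n, (rightCommutator t)^[n] x = 0) (hy : ∃ n, (rightCommutator t)^[n] y = 0) :
    ∃ n, (rightCommutator t)^[n] (x * y) = 0 := by
  obtain ⟨n, hn⟩ := hx
  obtain ⟨m, hm⟩ := hy
  refine ⟨n + m, ?_⟩
  rw [iterate_rightCommutator_mul n m (iterate_rightCommutator_eq_zero hn n.le_succ)
    (iterate_rightCommutator_eq_zero hm m.le_succ), hn, zero_mul, smul_zero]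

/-- For `t` the multiplication by the variable, this `n` plays the role of the order of the operator
`x`. -/
theorem exists_iterate_rightCommutator_ne_zero {t x : B} (hx0 : x ≠ 0)
    (hx : ∃ n, (rightCommutator t)^[n] x = 0) :
    ∃ n, (rightCommutator t)^[n] x ≠ 0 ∧ (rightCommutator t)^[n + 1] x = 0 := by
  classical
  have h1 : Nat.find hx ≠ 0 := fun h => hx0 (by simpa [h] using Nat.find_spec hx)
  obtain ⟨n, hn⟩ := Nat.exists_eq_succ_of_ne_zero h1
  exact ⟨n, Nat.find_min hx (by omega), by simpa [hn] using Nat.find_spec hx⟩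

end Commutator

/-! ### Order of operators, measured by commutators with `t`. -/

variable {k : Type*} [Field k]

theorem mulOp_apply (a x : RatFunc k) : mulOp k a x = a * x := rfl

/-- Commuting with `t` gives `k[t]`-linearity, then `k(t)`-linearity after clearing denominators,
and a `k(t)`-linear map is determined by its value at `1`. -/
theorem eq_mulOp_of_commute {x : Module.End k (RatFunc k)}
    (hx : Commute x (mulOp k RatFunc.X)) : x = mulOp k (x 1) := by
  have hp : ∀ p : k[X], Commute x (mulOp k (algebraMap k[X] (RatFunc k) p)) := by
    intro p
    induction p using Polynomial.induction_on' with
    | add p q hp hq => rw [map_add, map_add]; exact hp.add_right hq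
    | monomial n a =>
      rw [← C_mul_X_pow_eq_monomial, map_mul, map_mul, ← algebraMap_eq_C, AlgHom.commutes,
        map_pow, map_pow, RatFunc.algebraMap_X]
      exact (Algebra.commute_algebraMap_right a x).mul_right (hx.pow_right n)
  ext y
  obtain ⟨p, q, hq, rfl⟩ : ∃ p q : k[X], q ≠ 0 ∧
      algebraMap k[X] (RatFunc k) p / algebraMap k[X] (RatFunc k) q = y :=
    ⟨y.num, y.denom, y.denom_ne_zero, y.num_div_denom⟩
  have hq' := algebraMap_ne hq
  have h1 := LinearMap.congr_fun (hp p).eq 1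
  have h2 := LinearMap.congr_fun (hp q).eq
    (algebraMap k[X] (RatFunc k) p / algebraMap k[X] (RatFunc k) q)
  simp only [Module.End.mul_apply, mulOp_apply, mul_one] at h1 h2 ⊢
  rw [mul_div_cancel₀ _ hq', h1] at h2
  apply mul_left_cancel₀ hq'
  rw [← h2]
  field_simp

theorem exists_iterate_rightCommutator_of_mem_ratDiffOps {x : Module.End k (RatFunc k)}
    (hx : x ∈ ratDiffOps k) : ∃ n, (rightCommutator (mulOp k RatFunc.X))^[n] x = 0 := by
  induction hx using Algebra.adjoin_induction with
  | mem x hx =>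
    rcases hx with ⟨a, rfl⟩ | rfl
    · exact ⟨1, by
        rw [Function.iterate_one, rightCommutator_apply, ← map_mul, ← map_mul, mul_comm, sub_self]⟩
    · exact ⟨2, by
        rw [Function.iterate_succ_apply, rightCommutator_apply, weyl_relation,
          Function.iterate_one, rightCommutator_apply, one_mul, mul_one, sub_self]⟩
  | algebraMap r =>
    exact ⟨1, by rw [Function.iterate_one, rightCommutator_apply, Algebra.commutes, sub_self]⟩
  | add x y _ _ hx hy =>
    obtain ⟨n, hn⟩ := hx
    obtain ⟨m, hm⟩ := hy
    refine ⟨max n m, ?_⟩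
    rw [iterate_rightCommutator_add, iterate_rightCommutator_eq_zero hn (le_max_left n m),
      iterate_rightCommutator_eq_zero hm (le_max_right n m), add_zero]
  | mul x y _ _ hx hy => exact exists_iterate_rightCommutator_mul hx hy

/-- Invertible differential operators have order zero. -/
theorem eq_mulOp_of_mul_eq_one [CharZero k] {x y : Module.End k (RatFunc k)}
    (hx : x ∈ ratDiffOps k) (hy : y ∈ ratDiffOps k) (hxy : x * y = 1) : x = mulOp k (x 1) := by
  have hx0 : x ≠ 0 := by rintro rfl; simp at hxy
  have hy0 : y ≠ 0 := by rintro rfl; simp at hxy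
  obtain ⟨n, hn, hn'⟩ := exists_iterate_rightCommutator_ne_zero hx0
    (exists_iterate_rightCommutator_of_mem_ratDiffOps hx)
  obtain ⟨m, hm, hm'⟩ := exists_iterate_rightCommutator_ne_zero hy0
    (exists_iterate_rightCommutator_of_mem_ratDiffOps hy)
  have key := iterate_rightCommutator_mul n m hn' hm'
  have hcomm : ∀ {z : Module.End k (RatFunc k)} {i : ℕ},
      (rightCommutator (mulOp k RatFunc.X))^[i + 1] z = 0 →
      ∃ a, (rightCommutator (mulOp k RatFunc.X))^[i] z = mulOp k a := by
    intro z i h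
    rw [Function.iterate_succ_apply', rightCommutator_apply, sub_eq_zero] at h
    exact ⟨_, eq_mulOp_of_commute h⟩
  have hinj : ∀ {a : RatFunc k}, mulOp k a = 0 → a = 0 := fun {a} h => by
    simpa [mulOp_apply] using LinearMap.congr_fun h 1
  rcases Nat.eq_zero_or_pos n with rfl | hpos
  · rw [zero_add, Function.iterate_one, rightCommutator_apply, sub_eq_zero] at hn'
    exact eq_mulOp_of_commute hn'
  -- For order `n > 0`, the `(n + m)`-fold commutator of `x * y = 1` vanishes, yet it is a positive
  -- binomial coefficient times the product of the nonzero top symbols `a` and `b`.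
  exfalso
  obtain ⟨a, ha⟩ := hcomm hn'
  obtain ⟨b, hb⟩ := hcomm hm'
  have h1 : (rightCommutator (mulOp k RatFunc.X))^[n + m] 1 = 0 := by
    refine iterate_rightCommutator_eq_zero (n := 1) ?_ (by omega)
    rw [Function.iterate_one, rightCommutator_apply, one_mul, mul_one, sub_self]
  rw [hxy, h1, ha, hb, ← map_mul, ← map_nsmul] at key
  have h2 := hinj key.symm
  rw [nsmul_eq_mul, mul_eq_zero, mul_eq_zero] at h2
  rcases h2 with h | rfl | rfl
  · rw [← map_natCast (algebraMap k (RatFunc k)), map_eq_zero, Nat.cast_eq_zero] at h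
    exact (Nat.choose_pos (Nat.le_add_right n m)).ne' h
  · exact hn (by rw [ha, map_zero])
  · exact hm (by rw [hb, map_zero])

/-! ### Polynomials inside the Weyl algebra -/

section Weyl

variable {k : Type*} [Field k]

/-- A polynomial, as an element of the Weyl algebra. -/
def polyOp (p : k[X]) : weylAlgebra k := ⟨_, mulOp_poly_mem p⟩

theorem coe_polyOp (p : k[X]) :
    (polyOp p : Module.End k (RatFunc k)) = mulOp k (algebraMap k[X] (RatFunc k) p) := rfl

theorem polyOp_mul (p q : k[X]) : polyOp (p * q) = polyOp p * polyOp q :=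
  Subtype.ext (by rw [MulMemClass.coe_mul, coe_polyOp, map_mul, map_mul]; rfl)

theorem commute_polyOp (p q : k[X]) : Commute (polyOp p) (polyOp q) := by
  rw [Commute, SemiconjBy, ← polyOp_mul, mul_comm, polyOp_mul]

theorem del_mem_weylAlgebra : del k ∈ weylAlgebra k :=
  Algebra.subset_adjoin (Set.mem_insert_of_mem _ rfl)

theorem adjoin_weylGenerators : Algebra.adjoin k
    ((↑) ⁻¹' {mulOp k RatFunc.X, del k} : Set (weylAlgebra k)) = ⊤ :=
  Algebra.adjoin_adjoin_coe_preimage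

/-- Here `[p, t] = 0` and `[p, ∂] = -p'` are polynomials, so the exponential series of `ad p` is
linear on the generators. -/
theorem polyOp_commutator_generator (p : k[X]) :
    ∀ g ∈ ((↑) ⁻¹' {mulOp k RatFunc.X, del k} : Set (weylAlgebra k)),
      Commute (polyOp p) (polyOp p * g - g * polyOp p) := by
  rintro g (hg | hg)
  · obtain rfl : g = polyOp X := Subtype.ext (by rw [coe_polyOp, RatFunc.algebraMap_X]; exact hg)
    rw [(commute_polyOp p X).eq, sub_self]
    exact Commute.zero_right _
  · have : polyOp p * g - g * polyOp p = polyOp (-derivative p) := by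
      refine Subtype.ext ?_
      rw [AddSubgroupClass.coe_sub, MulMemClass.coe_mul, MulMemClass.coe_mul,
        show (g : Module.End k (RatFunc k)) = del k from hg, coe_polyOp, coe_polyOp, del_mulOp,
        ratDeriv_algebraMap, map_neg, map_neg]
      abel
    rw [this]
    exact commute_polyOp _ _

/-- The automorphism `exp (c ad p)` of the Weyl algebra, for a polynomial `p`. -/
def shearEquiv [CharZero k] (p : k[X]) (c : k) : weylAlgebra k ≃ₐ[k] weylAlgebra k :=
  flowEquiv adjoin_weylGenerators (polyOp_commutator_generator p) c

theorem shearEquiv_polyOp [CharZero k] (p : k[X]) (c : k) (q : k[X]) :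
    shearEquiv p c (polyOp q) = polyOp q :=
  flowHom_of_commute _ _ c (commute_polyOp p q)

/-- The Ore condition for powers of a polynomial. -/
theorem exists_mul_pow_eq_pow_mul (c : k[X]) {x : Module.End k (RatFunc k)}
    (hx : x ∈ weylAlgebra k) : ∀ m : ℕ, ∃ N : ℕ, ∃ e ∈ weylAlgebra k,
      x * mulOp k (algebraMap k[X] (RatFunc k) (c ^ N))
        = mulOp k (algebraMap k[X] (RatFunc k) (c ^ m)) * e := by
  have hpow : ∀ {x : Module.End k (RatFunc k)} {m N M : ℕ}, N ≤ M → (∃ e ∈ weylAlgebra k,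
      x * mulOp k (algebraMap k[X] (RatFunc k) (c ^ N))
        = mulOp k (algebraMap k[X] (RatFunc k) (c ^ m)) * e) → ∃ e ∈ weylAlgebra k,
      x * mulOp k (algebraMap k[X] (RatFunc k) (c ^ M))
        = mulOp k (algebraMap k[X] (RatFunc k) (c ^ m)) * e := by
    rintro x m N M h ⟨e, he, hxe⟩
    obtain ⟨i, rfl⟩ := Nat.exists_eq_add_of_le h
    refine ⟨e * mulOp k (algebraMap k[X] (RatFunc k) (c ^ i)), mul_mem he (mulOp_poly_mem _), ?_⟩
    rw [pow_add, map_mul, map_mul, ← mul_assoc, hxe, mul_assoc]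
  induction hx using Algebra.adjoin_induction with
  | mem x hx =>
    intro m
    rcases hx with rfl | rfl
    · refine ⟨m, mulOp k RatFunc.X, Algebra.subset_adjoin (Set.mem_insert _ _), ?_⟩
      rw [← map_mul, mul_comm, map_mul]
    -- One power of `c` is lost for each `∂`: `∂ c^(m+1) = c^m (c ∂ + (m+1) c')`.
    · refine ⟨m + 1, mulOp k (algebraMap k[X] (RatFunc k) c) * del k
        + mulOp k (algebraMap k[X] (RatFunc k) (C ((m : k) + 1) * derivative c)),
        add_mem (mul_mem (mulOp_poly_mem _) del_mem_weylAlgebra) (mulOp_poly_mem _), ?_⟩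
      have h : derivative (c ^ (m + 1)) = c ^ m * (C ((m : k) + 1) * derivative c) := by
        rw [derivative_pow_succ]; ring
      rw [del_mulOp, ratDeriv_algebraMap, mul_add, ← mul_assoc, ← map_mul, ← map_mul, ← map_mul,
        ← map_mul, h, ← pow_succ]
  | algebraMap r =>
    exact fun m => ⟨m, _, Subalgebra.algebraMap_mem _ r, Algebra.commutes _ _⟩
  | add x y _ _ hx hy =>
    intro m
    obtain ⟨N, hN⟩ := hx m
    obtain ⟨M, hM⟩ := hy m
    obtain ⟨e, he, h1⟩ := hpow (le_max_left N M) hN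
    obtain ⟨f, hf, h2⟩ := hpow (le_max_right N M) hM
    exact ⟨max N M, e + f, add_mem he hf, by rw [add_mul, mul_add, h1, h2]⟩
  | mul x y _ _ hx hy =>
    intro m
    obtain ⟨M, e, he, h1⟩ := hx m
    obtain ⟨N, f, hf, h2⟩ := hy M
    exact ⟨N, e * f, mul_mem he hf, by rw [mul_assoc, h2, ← mul_assoc, h1, mul_assoc]⟩

/-! ### Homomorphisms between right ideals. -/

theorem mulOp_inv_mul_mulOp {a : RatFunc k} (ha : a ≠ 0) : mulOp k a⁻¹ * mulOp k a = 1 := by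
  rw [← map_mul, inv_mul_cancel₀ ha, map_one]

theorem mulOp_mem_ratDiffOps (a : RatFunc k) : mulOp k a ∈ ratDiffOps k :=
  Algebra.subset_adjoin (Or.inl ⟨a, rfl⟩)

/-- A homomorphism between right ideals of the Weyl algebra is a left multiplication. -/
theorem exists_eq_mul_of_linearMap {I J : Submodule (weylAlgebra k)ᵐᵒᵖ (weylAlgebra k)}
    {c : k[X]} (hc : c ≠ 0) (hJ : polyOp c ∈ J) (φ : J →ₗ[(weylAlgebra k)ᵐᵒᵖ] I) :
    ∃ x ∈ ratDiffOps k, ∀ d : J, ((φ d).1 : Module.End k (RatFunc k)) = x * d.1 := by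
  set γ := algebraMap k[X] (RatFunc k) c with hγ
  have hγ0 : γ ≠ 0 := algebraMap_ne hc
  -- The multiplier must be `φ(c) c⁻¹`. By the Ore condition `d c^N = c e`, so linearity gives `φ(d)
  -- c^N = φ(c) e`, and `c^N` cancels.
  refine ⟨((φ ⟨_, hJ⟩).1 : Module.End k (RatFunc k)) * mulOp k γ⁻¹,
    mul_mem (weylAlgebra_le k (φ ⟨_, hJ⟩).1.2) (mulOp_mem_ratDiffOps _), fun d => ?_⟩
  obtain ⟨N, e, he, h⟩ := exists_mul_pow_eq_pow_mul c d.1.2 1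
  rw [pow_one] at h
  have h1 : MulOpposite.op (polyOp (c ^ N)) • d
      = MulOpposite.op (⟨e, he⟩ : weylAlgebra k) • (⟨_, hJ⟩ : J) :=
    Subtype.ext (Subtype.ext h)
  have h2 := congrArg φ h1
  rw [map_smul, map_smul] at h2
  have h3 : ((φ d).1 : Module.End k (RatFunc k)) * mulOp k (algebraMap k[X] (RatFunc k) (c ^ N))
      = (φ ⟨_, hJ⟩).1 * e := congrArg (fun z : I => (z.1 : Module.End k (RatFunc k))) h2
  have h4 : IsUnit (mulOp k (algebraMap k[X] (RatFunc k) (c ^ N))) :=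
    IsUnit.map _ (algebraMap_ne (pow_ne_zero N hc)).isUnit
  rw [← h4.mul_left_inj, h3, mul_assoc, mul_assoc, h, ← mul_assoc (mulOp k γ⁻¹),
    mulOp_inv_mul_mulOp hγ0, one_mul]

/-- An isomorphism between right ideals that contain nonzero polynomials is the multiplication
by a rational function. -/
theorem exists_eq_mulOp_mul_of_linearEquiv [CharZero k]
    {I J : Submodule (weylAlgebra k)ᵐᵒᵖ (weylAlgebra k)} {c : k[X]} (hc : c ≠ 0)
    (hJ : polyOp c ∈ J) (hI : polyOp c ∈ I) (φ : J ≃ₗ[(weylAlgebra k)ᵐᵒᵖ] I) :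
    ∃ ξ η : RatFunc k, ξ * η = 1 ∧
      (∀ d : J, ((φ d).1 : Module.End k (RatFunc k)) = mulOp k ξ * d.1) ∧
      ∀ d : I, ((φ.symm d).1 : Module.End k (RatFunc k)) = mulOp k η * d.1 := by
  obtain ⟨x, hx, hφ⟩ := exists_eq_mul_of_linearMap hc hJ φ.toLinearMap
  obtain ⟨y, hy, hψ⟩ := exists_eq_mul_of_linearMap hc hI φ.symm.toLinearMap
  simp only [LinearEquiv.coe_coe] at hφ hψ
  have h4 : IsUnit (mulOp k (algebraMap k[X] (RatFunc k) c)) :=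
    IsUnit.map _ (algebraMap_ne hc).isUnit
  have hxy : x * y = 1 := by
    rw [← h4.mul_left_inj, one_mul, mul_assoc, ← coe_polyOp, ← hψ ⟨_, hI⟩, ← hφ,
      LinearEquiv.apply_symm_apply]
  have hyx : y * x = 1 := by
    rw [← h4.mul_left_inj, one_mul, mul_assoc, ← coe_polyOp, ← hφ ⟨_, hJ⟩, ← hψ,
      LinearEquiv.symm_apply_apply]
  have ex := eq_mulOp_of_mul_eq_one hx hy hxy
  have ey := eq_mulOp_of_mul_eq_one hy hx hyx
  refine ⟨x 1, y 1, ?_, by rwa [← ex], by rwa [← ey]⟩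
  have := LinearMap.congr_fun hxy 1
  rwa [ex, ey, ← map_mul, mulOp_apply, mul_one] at this

end Weyl

/-! ### The right ideal of a subspace -/

section IdealOf

variable {k : Type*} [Field k] {V W : Submodule k k[X]}

theorem algebraMap_mem_inRat {p : k[X]} :
    algebraMap k[X] (RatFunc k) p ∈ inRat V ↔ p ∈ V := by
  rw [mem_inRat]
  refine ⟨?_, fun h => ⟨p, h, rfl⟩⟩
  rintro ⟨q, hq, h⟩
  rwa [← RatFunc.algebraMap_injective k h]

theorem mem_idealOf {d : weylAlgebra k} :
    d ∈ idealOf V ↔ ∀ p : k[X], d.1 (algebraMap k[X] (RatFunc k) p) ∈ inRat V := by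
  refine ⟨fun h p => h.2 _ (poly_mem_inRat_top p), fun h => ⟨weylAlgebra_le k d.2, ?_⟩⟩
  intro v hv
  obtain ⟨p, -, rfl⟩ := mem_inRat.1 hv
  exact h p

theorem mem_conductor {a : k[X]} : a ∈ conductor V ↔ ∀ r : k[X], a * r ∈ V := Iff.rfl

theorem polyOp_mem_idealOf {a : k[X]} : polyOp a ∈ idealOf V ↔ a ∈ conductor V := by
  rw [mem_idealOf, mem_conductor]
  refine forall_congr' fun p => ?_
  rw [coe_polyOp, mulOp_apply, ← map_mul, algebraMap_mem_inRat]

theorem polyOp_mul_mem_idealOf {s : k[X]} (hs : s ∈ stab V) {d : weylAlgebra k}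
    (hd : d ∈ idealOf V) : polyOp s * d ∈ idealOf V := by
  rw [mem_idealOf] at hd ⊢
  intro p
  obtain ⟨v, hv, h⟩ := mem_inRat.1 (hd p)
  rw [MulMemClass.coe_mul, Module.End.mul_apply, ← h, coe_polyOp, mulOp_apply, ← map_mul,
    algebraMap_mem_inRat]
  exact hs v hv

theorem shearEquiv_mem_staffordOf [CharZero k] {s : k[X]} (hs : s ∈ stab V) (c : k) :
    shearEquiv s c ∈ staffordOf V :=
  flowEquiv_mem_stafford _ _ (fun _ hd => polyOp_mul_mem_idealOf hs hd) c

theorem exists_mem_conductor_of_mulOp_mul_polyOp {ξ : RatFunc k} {g : k[X]} {d : weylAlgebra k}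
    (hd : d ∈ idealOf V) (h : (d : Module.End k (RatFunc k)) = mulOp k ξ * (polyOp g).1) :
    ∃ u ∈ conductor V, ξ * algebraMap k[X] (RatFunc k) g = algebraMap k[X] (RatFunc k) u := by
  obtain ⟨u, -, hu⟩ := mem_inRat.1 (mem_idealOf.1 hd 1)
  rw [h, coe_polyOp, ← map_mul, mulOp_apply, map_one, mul_one] at hu
  refine ⟨u, ?_, hu.symm⟩
  rw [← polyOp_mem_idealOf]
  convert hd
  refine Subtype.ext ?_
  rw [h, coe_polyOp, coe_polyOp, ← map_mul, hu]

/-- An element of the Stafford subgroup that fixes the polynomials maps the ideal to itself. -/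
theorem apply_mem_idealOf_of_mem_staffordOf [CharZero k] (hV : conductor V ≠ ⊥)
    {σ : weylAlgebra k ≃ₐ[k] weylAlgebra k} (hσ : ∀ q : k[X], σ (polyOp q) = polyOp q)
    (hmem : σ ∈ staffordOf V) {d : weylAlgebra k} (hd : d ∈ idealOf V) : σ d ∈ idealOf V := by
  obtain ⟨φ⟩ := hmem
  obtain ⟨g, hg⟩ := (IsPrincipalIdealRing.principal (conductor V)).principal
  have hg0 : g ≠ 0 := by
    rintro rfl
    exact hV (hg.trans (Submodule.span_zero_singleton _))
  have hgI : polyOp g ∈ idealOf V := by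
    rw [polyOp_mem_idealOf, hg]; exact Submodule.mem_span_singleton_self g
  have hgJ : polyOp g ∈ mapIdeal σ (idealOf V) := ⟨_, hgI, hσ g⟩
  obtain ⟨ξ, η, hξη, hφ, hψ⟩ := exists_eq_mulOp_mul_of_linearEquiv hg0 hgJ hgI φ
  have hpoly : ∀ {ζ : RatFunc k} {e : weylAlgebra k}, e ∈ idealOf V →
      (e : Module.End k (RatFunc k)) = mulOp k ζ * (polyOp g).1 →
      ∃ u : k[X], ζ = algebraMap k[X] (RatFunc k) u := by
    intro ζ e he h
    obtain ⟨u, hu, h'⟩ := exists_mem_conductor_of_mulOp_mul_polyOp he h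
    rw [hg] at hu
    obtain ⟨a, rfl⟩ := Ideal.mem_span_singleton'.1 hu
    refine ⟨a, mul_right_cancel₀ (algebraMap_ne hg0) ?_⟩
    rw [h', map_mul]
  -- The element `φ(g) = ξ g` lies in the conductor `(g)`, so `ξ` is a polynomial.
  obtain ⟨u, rfl⟩ := hpoly (φ ⟨_, hgJ⟩).2 (hφ ⟨_, hgJ⟩)
  obtain ⟨v, rfl⟩ : ∃ v : k[X], η = algebraMap k[X] (RatFunc k) v := by
    obtain ⟨z, hz, hz'⟩ := (φ.symm ⟨_, hgI⟩).2
    have h1 : ((φ.symm ⟨_, hgI⟩).1 : Module.End k (RatFunc k)) = mulOp k η * (polyOp g).1 :=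
      hψ ⟨_, hgI⟩
    -- With `V := ⊤` the ideal is all of `A₁`, which shows only that `η g` is a polynomial `w`. As
    -- `σ` fixes `w`, its preimage in `idealOf V` is `w` itself, so `g` divides `w`.
    obtain ⟨w, -, hw⟩ := exists_mem_conductor_of_mulOp_mul_polyOp
      (V := ⊤) (mem_idealOf.2 fun p => weyl_apply_poly (Subtype.prop _) _ (poly_mem_inRat_top p)) h1
    rw [coe_polyOp, ← map_mul, hw] at h1
    have h2 : z = polyOp w := σ.injective (hz'.trans ((Subtype.ext h1).trans (hσ w).symm))
    refine hpoly hz ?_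
    rw [h2, coe_polyOp, coe_polyOp, ← map_mul, hw]
  rw [← map_mul, ← map_one (algebraMap k[X] (RatFunc k))] at hξη
  obtain ⟨c, hc, rfl⟩ := Polynomial.isUnit_iff.1
    (IsUnit.of_mul_eq_one _ (RatFunc.algebraMap_injective k hξη))
  have hd' : σ d ∈ mapIdeal σ (idealOf V) := ⟨d, hd, rfl⟩
  have h3 := (φ ⟨_, hd'⟩).2
  rw [mem_idealOf] at h3 ⊢
  intro p
  have h4 := h3 p
  rwa [hφ, Module.End.mul_apply, mulOp_apply, ← algebraMap_eq_C, ← Algebra.smul_def,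
    Submodule.smul_mem_iff _ hc.ne_zero] at h4

end IdealOf

/-! ### Primary decomposable subspaces as images of differential operators -/

/-- The ideal `b²R` lies in `O(b)`, so `b²v` is in the conductor for every `v ∈ V`. -/
theorem conductor_ne_bot {k : Type*} [Field k] {V : Submodule k k[X]} (hV : IsPrimaryDecomposable V) :
    conductor V ≠ ⊥ := by
  obtain ⟨hV0, b, hb, hbV⟩ := hV
  obtain ⟨v, hv, hv0⟩ := Submodule.exists_mem_ne_zero_of_ne_bot hV0
  refine (Submodule.ne_bot_iff _).2 ⟨b ^ 2 * v, fun r => ?_, mul_ne_zero (pow_ne_zero 2 hb) hv0⟩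
  have hr : b ^ 2 * r ∈ primaryAlg b := by
    change b ∣ derivative (b ^ 2 * r)
    rw [derivative_mul, derivative_pow]
    exact ⟨C 2 * derivative b * r + b * derivative r, by push_cast; ring⟩
  have := hbV hr v hv
  rwa [mul_right_comm] at this

section Primary

variable {k : Type*} [Field k]

/-- The operator `∑ (-u)ⁱ ∂ⁱ / i!`, truncated at `i = n`. -/
def taylorOp (u : k[X]) (n : ℕ) : weylAlgebra k :=
  ∑ i ∈ Finset.range (n + 1),
    polyOp (C ((i.factorial : k)⁻¹) * (-u) ^ i) * ⟨del k, del_mem_weylAlgebra⟩ ^ i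

theorem taylorOp_apply (u : k[X]) (n : ℕ) (p : k[X]) :
    (taylorOp u n).1 (algebraMap k[X] (RatFunc k) p) = algebraMap k[X] (RatFunc k)
      (∑ i ∈ Finset.range (n + 1), C ((i.factorial : k)⁻¹) * (-u) ^ i * derivative^[i] p) := by
  rw [taylorOp, AddSubmonoidClass.coe_finsetSum, LinearMap.sum_apply, map_sum]
  refine Finset.sum_congr rfl fun i _ => ?_
  rw [MulMemClass.coe_mul, Module.End.mul_apply, SubmonoidClass.coe_pow, del_pow_poly,
    coe_polyOp, mulOp_apply]
  exact (map_mul _ _ _).symm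

theorem taylorOp_apply_one (u : k[X]) (n : ℕ) : (taylorOp u n).1 1 = 1 := by
  rw [← map_one (algebraMap k[X] (RatFunc k)), taylorOp_apply, Finset.sum_eq_single 0]
  · simp
  · intro i _ hi
    rw [iterate_derivative_one (Nat.pos_of_ne_zero hi), mul_zero]
  · simp

variable [CharZero k]

/-- Successive approximation: since `c'` is invertible modulo `c`, subtracting a suitable multiple
of `c^(m+1)` from `u` cancels the error `c^m h` in `u' - 1` modulo `c^(m+1)`. -/
theorem exists_dvd_and_pow_dvd_derivative_sub_one {c : k[X]} (hc : c.Separable) (m : ℕ) :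
    ∃ u : k[X], c ∣ u ∧ c ^ m ∣ derivative u - 1 := by
  induction m with
  | zero => exact ⟨0, dvd_zero c, by simp⟩
  | succ m ih =>
    obtain ⟨u, hu, h, hh⟩ := ih
    obtain ⟨x, y, hxy⟩ := hc
    have hm : C ((m : k) + 1) * C ((m : k) + 1)⁻¹ = 1 := by
      rw [← C_mul, mul_inv_cancel₀ (Nat.cast_add_one_ne_zero m), C_1]
    refine ⟨u - c ^ (m + 1) * (C ((m : k) + 1)⁻¹ * (y * h)),
      dvd_sub hu ((dvd_pow_self c m.succ_ne_zero).mul_right _),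
      x * h - derivative (C ((m : k) + 1)⁻¹ * (y * h)), ?_⟩
    rw [derivative_sub, derivative_mul (f := c ^ (m + 1)), derivative_pow_succ]
    linear_combination hh - c ^ m * h * hxy - (c ^ m * derivative c * y * h) * hm

/-- The sum is a truncation of the formal expansion of `p(t - u)`. When `u' ≡ 1` its derivative
telescopes, leaving the top term. -/
theorem dvd_derivative_taylor {b u : k[X]} (hu : b ∣ derivative u - 1) (n : ℕ) (p : k[X]) :
    b ∣ derivative
        (∑ i ∈ Finset.range (n + 1), C ((i.factorial : k)⁻¹) * (-u) ^ i * derivative^[i] p)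
      - C ((n.factorial : k)⁻¹) * (-u) ^ n * derivative^[n + 1] p := by
  induction n with
  | zero => simp
  | succ n ih =>
    have hf : C (((n + 1).factorial : k)⁻¹) * C ((n : k) + 1) = C ((n.factorial : k)⁻¹) := by
      rw [← C_mul, Nat.factorial_succ]
      congr 1
      have := Nat.cast_add_one_ne_zero (R := k) n
      push_cast
      field_simp
    rw [Finset.sum_range_succ, derivative_add]
    obtain ⟨q, hq⟩ := ih
    obtain ⟨r, hr⟩ := hu
    refine ⟨q - r * (C ((n.factorial : k)⁻¹) * (-u) ^ n * derivative^[n + 1] p), ?_⟩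
    rw [derivative_mul, derivative_C_mul, derivative_pow_succ, derivative_neg,
      ← Function.iterate_succ_apply' derivative]
    linear_combination hq - (C ((n.factorial : k)⁻¹) * (-u) ^ n * derivative^[n + 1] p) * hr
      - (derivative u * (-u) ^ n * derivative^[n + 1] p) * hf

/-- With `c` squarefree and `b ∣ cⁿ`, choose `u` with `c ∣ u` and `u' ≡ 1` modulo `cⁿ`. The leftover
top term contains `uⁿ`, hence is divisible by `b`. -/
theorem exists_weyl_apply_one_eq_one_and_dvd_derivative {b : k[X]} (hb : b ≠ 0) :
    ∃ e : weylAlgebra k, e.1 1 = 1 ∧ ∀ p : k[X], ∃ q ∈ primaryAlg b,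
      e.1 (algebraMap k[X] (RatFunc k) p) = algebraMap k[X] (RatFunc k) q := by
  obtain ⟨c, n, hc, -, hbc⟩ := exists_squarefree_dvd_pow_of_ne_zero hb
  obtain ⟨u, hu, hu'⟩ := exists_dvd_and_pow_dvd_derivative_sub_one
    (PerfectField.separable_iff_squarefree.2 hc) n
  refine ⟨taylorOp u n, taylorOp_apply_one u n, fun p => ⟨_, ?_, taylorOp_apply u n p⟩⟩
  change b ∣ derivative _
  refine (dvd_iff_dvd_of_dvd_sub (dvd_derivative_taylor (hbc.trans hu') n p)).2 ?_
  exact ((hbc.trans (pow_dvd_pow_of_dvd ((dvd_neg).2 hu) n)).mul_left _).mul_right _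

/-- The operator `v e`, with `e(1) = 1` and `e(R) ⊆ O(b)`, sends `R` into `O(b)v ⊆ V`. Thus `V` can
be recovered from its ideal by evaluation at `1`. -/
theorem exists_mem_idealOf_apply_one {V : Submodule k k[X]} (hV : IsPrimaryDecomposable V)
    {v : k[X]} (hv : v ∈ V) :
    ∃ d ∈ idealOf V, d.1 1 = algebraMap k[X] (RatFunc k) v := by
  obtain ⟨-, b, hb, hbV⟩ := hV
  obtain ⟨e, he, he'⟩ := exists_weyl_apply_one_eq_one_and_dvd_derivative hb
  refine ⟨polyOp v * e, mem_idealOf.2 fun p => ?_, ?_⟩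
  · obtain ⟨q, hq, h⟩ := he' p
    rw [MulMemClass.coe_mul, Module.End.mul_apply, h, coe_polyOp, mulOp_apply, ← map_mul,
      algebraMap_mem_inRat, mul_comm]
    exact hbV hq v hv
  · rw [MulMemClass.coe_mul, Module.End.mul_apply, he, coe_polyOp, mulOp_apply, mul_one]

theorem mem_stab_of_forall_polyOp_mul_mem {V : Submodule k k[X]} (hV : IsPrimaryDecomposable V)
    {s : k[X]} (hs : ∀ d ∈ idealOf V, polyOp s * d ∈ idealOf V) : s ∈ stab V := by
  intro v hv
  obtain ⟨d, hd, h⟩ := exists_mem_idealOf_apply_one hV hv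
  have := mem_idealOf.1 (hs d hd) 1
  rwa [map_one, MulMemClass.coe_mul, Module.End.mul_apply, h, coe_polyOp, mulOp_apply, ← map_mul,
    algebraMap_mem_inRat] at this

theorem stab_le_stab_of_staffordOf_le {V W : Submodule k k[X]} (hW : IsPrimaryDecomposable W)
    (hH : staffordOf V ≤ staffordOf W) : stab V ≤ stab W := fun s hs =>
  mem_stab_of_forall_polyOp_mul_mem hW fun _ hd =>
    mul_mem_of_forall_flowEquiv_mem _ (polyOp_commutator_generator s) hd fun c =>
      apply_mem_idealOf_of_mem_staffordOf (conductor_ne_bot hW) (shearEquiv_polyOp s c)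
        (hH (shearEquiv_mem_staffordOf hs c)) hd

end Primary

/-- If `aR ⊆ S(V)`, then `a(RV) ⊆ V`, and `RV = R` by irreducibility. Conversely, `aR ⊆ V` gives
`aRV ⊆ aR ⊆ V`. -/
theorem mem_conductor_iff_of_irreducible {k : Type*} [Field k] {V : Submodule k k[X]}
    (hV : IsPDIrreducible V) {a : k[X]} :
    a ∈ conductor V ↔ ∀ r : k[X], a * r ∈ stab V := by
  refine ⟨fun ha r v _ => by rw [mul_assoc]; exact ha _, fun ha r => ?_⟩
  have htop : Ideal.span (V : Set k[X]) = ⊤ := by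
    by_contra h
    exact hV.2 ⟨_, h, Ideal.subset_span⟩
  have key : ∀ x ∈ Ideal.span (V : Set k[X]), a * x ∈ V := by
    intro x hx
    induction hx using Submodule.closure_induction with
    | zero => rw [mul_zero]; exact V.zero_mem
    | add x y _ _ hx hy => rw [mul_add]; exact V.add_mem hx hy
    | smul_mem r x hx => rw [smul_eq_mul, ← mul_assoc]; exact ha r x hx
  exact key r (htop ▸ Submodule.mem_top)

end FirstWeyl

end

theorem mainTheorem5 {k : Type*} [Field k] [CharZero k] (V W : Submodule k (Polynomial k))
    (hV : FirstWeyl.IsPDIrreducible V) (hW : FirstWeyl.IsPDIrreducible W)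
    (hH : FirstWeyl.staffordOf V ≤ FirstWeyl.staffordOf W) :
    FirstWeyl.stab V ≤ FirstWeyl.stab W ∧ FirstWeyl.conductor V ≤ FirstWeyl.conductor W := by
  have h := FirstWeyl.stab_le_stab_of_staffordOf_le hW.1 hH
  refine ⟨h, fun a ha => ?_⟩
  rw [FirstWeyl.mem_conductor_iff_of_irreducible hW]
  exact fun r => h ((FirstWeyl.mem_conductor_iff_of_irreducible hV).1 ha r)
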